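/- Let $X=\mathbb{R}^n$ with Lebesgue measure, and for $a\in\mathbb{Z}^n$ let $\chi_a$ be the characteristic function of the unit cube $K_a=a+\,]-1/2,1/2]^n$. Let $1<p<2$, let $q$ be given by $\frac1p=\frac12+\frac1q$, and let $(\lambda_a)_{a\in\mathbb{Z}^n}$ be a family of strictly positive real numbers. Let $\mathcal{L}=\ell^2_\lambda(L^p)$ be the space of all (a.e. equivalence classes of) measurable functions $f:X\to\mathbb{C}$ such that $$\|f\|_{\mathcal{L}}:=\Big(\sum_{a\in\mathbb{Z}^n}\|\lambda_a\chi_a f\|_{L^p}^2\Big)^{1/2}<\infty,$$ equipped with this norm, and let $\mathcal{M}=\ell^\infty_\lambda(L^q)$ be the space of all (classes of) measurable functions $g:X\to\mathbb{C}$ such that $\sup_{a\in\mathbb{Z}^n}\|\lambda_a\chi_a g\|_{L^q}<\infty$. **Theorem 9.7.** Let $\mathcal{H}$ be a complex Hilbert space and $T:\mathcal{H}\to\mathcal{L}$ a continuous linear map. Then there exist a continuous linear map $R:\mathcal{H}\to L^2(X)$ and a function $g\in\mathcal{M}$ with $g\ge 0$ almost everywhere such that $T=g(Q)R$, where $g(Q)$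 is the operator of multiplication by $g$; that is, $Tu=g\cdot(Ru)$ almost everywhere on $X$ for every $u\in\mathcal{H}$. -/

import Mathlib

open MeasureTheory
open scoped ENNReal ComplexOrder

namespace Amalgam

/-- `L⁰(ℝⁿ)`: the almost-everywhere classes of complex measurable functions on `ℝⁿ`, equipped
with Lebesgue measure. -/
abbrev LZero (n : ℕ) : Type :=
  EuclideanSpace ℝ (Fin n) →ₘ[(volume : Measure (EuclideanSpace ℝ (Fin n)))] ℂ

/-- The half-open unit cube `K_a = a + ]-1/2, 1/2]ⁿ` centred at the lattice point `a ∈ ℤⁿ`. -/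
def cube {n : ℕ} (a : Fin n → ℤ) : Set (EuclideanSpace ℝ (Fin n)) :=
  {x | ∀ i, x i ∈ Set.Ioc ((a i : ℝ) - 1 / 2) ((a i : ℝ) + 1 / 2)}

/-- The number `‖λ_a χ_a f‖_{L^r} ∈ [0, ∞]`, where `χ_a` is the characteristic function of
the cube `K_a`. -/
noncomputable def localNorm {n : ℕ} (lam : (Fin n → ℤ) → Set.Ioi (0 : ℝ)) (r : ℝ≥0∞)
    (f : LZero n) (a : Fin n → ℤ) : ℝ≥0∞ :=
  eLpNorm (fun x => ((lam a : ℝ) : ℂ) * (cube a).indicator (f : _ → ℂ) x) r volume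

/-- The number `(∑_a ‖λ_a χ_a f‖_{L^p}²)^{1/2} ∈ [0, ∞]`. -/
noncomputable def ellTwoNorm {n : ℕ} (lam : (Fin n → ℤ) → Set.Ioi (0 : ℝ)) (p : ℝ≥0∞)
    (f : LZero n) : ℝ≥0∞ :=
  (∑' a : Fin n → ℤ, localNorm lam p f a ^ (2 : ℝ)) ^ (1 / 2 : ℝ)

/-- The number `sup_a ‖λ_a χ_a g‖_{L^q} ∈ [0, ∞]`. -/
noncomputable def ellInftyNorm {n : ℕ} (lam : (Fin n → ℤ) → Set.Ioi (0 : ℝ)) (q : ℝ≥0∞)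
    (g : LZero n) : ℝ≥0∞ :=
  ⨆ a : Fin n → ℤ, localNorm lam q g a

section Facts

variable {n : ℕ}

theorem measurableSet_cube (a : Fin n → ℤ) : MeasurableSet (cube a) := by
  have : cube a = ⋂ i, (fun x : EuclideanSpace ℝ (Fin n) => x i) ⁻¹'
      Set.Ioc ((a i : ℝ) - 1 / 2) ((a i : ℝ) + 1 / 2) := by
    ext x; simp [cube]
  rw [this]
  exact MeasurableSet.iInter fun i => measurableSet_Ioc.preimage (by fun_prop)

theorem exists_mem_cube (x : EuclideanSpace ℝ (Fin n)) : ∃ a : Fin n → ℤ, x ∈ cube a := by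
  refine ⟨fun i => ⌈x i - 1 / 2⌉, fun i => ⟨?_, ?_⟩⟩
  · linarith [Int.ceil_lt_add_one (x i - 1 / 2)]
  · linarith [Int.le_ceil (x i - 1 / 2)]

variable (lam : (Fin n → ℤ) → Set.Ioi (0 : ℝ)) (p : ℝ≥0∞)

theorem aestronglyMeasurable_local (f : LZero n) (a : Fin n → ℤ) :
    AEStronglyMeasurable
      (fun x => ((lam a : ℝ) : ℂ) * (cube a).indicator (f : _ → ℂ) x) volume :=
  (f.aestronglyMeasurable.indicator (measurableSet_cube a)).const_mul _

theorem localNorm_add_le [Fact (1 ≤ p)] (f g : LZero n) (a : Fin n → ℤ) :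
    localNorm lam p (f + g) a ≤ localNorm lam p f a + localNorm lam p g a := by
  refine le_trans (le_of_eq ?_) (eLpNorm_add_le (aestronglyMeasurable_local lam f a)
    (aestronglyMeasurable_local lam g a) Fact.out)
  refine eLpNorm_congr_ae ?_
  filter_upwards [AEEqFun.coeFn_add f g] with x hx
  by_cases h : x ∈ cube a <;> simp [h, hx, mul_add]

theorem localNorm_smul (c : ℂ) (f : LZero n) (a : Fin n → ℤ) :
    localNorm lam p (c • f) a = ‖c‖ₑ * localNorm lam p f a := by
  unfold localNorm
  rw [← eLpNorm_const_smul]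
  refine eLpNorm_congr_ae ?_
  filter_upwards [AEEqFun.coeFn_smul c f] with x hx
  by_cases h : x ∈ cube a <;> simp [h, hx, mul_left_comm]

theorem localNorm_zero (a : Fin n → ℤ) : localNorm lam p 0 a = 0 := by
  rw [← zero_smul ℂ (0 : LZero n), localNorm_smul, enorm_zero, zero_mul]

theorem ellTwoNorm_add_le [Fact (1 ≤ p)] (f g : LZero n) :
    ellTwoNorm lam p (f + g) ≤ ellTwoNorm lam p f + ellTwoNorm lam p g := by
  have key := ENNReal.lintegral_Lp_add_le (μ := Measure.count) (p := 2)
    (f := localNorm lam p f) (g := localNorm lam p g)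
    (measurable_of_countable _).aemeasurable (measurable_of_countable _).aemeasurable
    (by norm_num)
  simp only [lintegral_count, Pi.add_apply] at key
  refine le_trans ?_ key
  unfold ellTwoNorm
  gcongr with a
  exact localNorm_add_le lam p f g a

theorem ellTwoNorm_smul (c : ℂ) (f : LZero n) :
    ellTwoNorm lam p (c • f) = ‖c‖ₑ * ellTwoNorm lam p f := by
  unfold ellTwoNorm
  simp_rw [localNorm_smul, ENNReal.mul_rpow_of_nonneg _ _ (zero_le_two (α := ℝ))]
  rw [ENNReal.tsum_mul_left, ENNReal.mul_rpow_of_nonneg _ _ (by norm_num), ← ENNReal.rpow_mul]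
  norm_num

theorem ellTwoNorm_zero : ellTwoNorm lam p (0 : LZero n) = 0 := by
  rw [← zero_smul ℂ (0 : LZero n), ellTwoNorm_smul, enorm_zero, zero_mul]

theorem eq_zero_of_ellTwoNorm [Fact (1 ≤ p)] (f : LZero n) (hf : ellTwoNorm lam p f = 0) :
    f = 0 := by
  have hp : p ≠ 0 := (zero_lt_one.trans_le (Fact.out : 1 ≤ p)).ne'
  have h1 : ∀ a, localNorm lam p f a = 0 := by
    have h0 : ∑' a : Fin n → ℤ, localNorm lam p f a ^ (2 : ℝ) = 0 :=
      (ENNReal.rpow_eq_zero_iff_of_pos (by norm_num)).1 hf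
    exact fun a =>
      (ENNReal.rpow_eq_zero_iff_of_pos (by norm_num)).1 (ENNReal.tsum_eq_zero.1 h0 a)
  have h2 : ∀ᵐ x ∂(volume : Measure (EuclideanSpace ℝ (Fin n))), ∀ a : Fin n → ℤ,
      ((lam a : ℝ) : ℂ) * (cube a).indicator (f : _ → ℂ) x = 0 :=
    ae_all_iff.2 fun a =>
      (eLpNorm_eq_zero_iff (aestronglyMeasurable_local lam f a) hp).1 (h1 a)
  refine AEEqFun.ext ?_
  filter_upwards [h2, AEEqFun.coeFn_zero (β := ℂ)
    (μ := (volume : Measure (EuclideanSpace ℝ (Fin n))))] with x hx h0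
  obtain ⟨a, ha⟩ := exists_mem_cube x
  have hl : ((lam a : ℝ) : ℂ) ≠ 0 := by exact_mod_cast (lam a).2.ne'
  have := hx a
  rw [Set.indicator_of_mem ha] at this
  rw [h0]
  simpa [hl] using this

end Facts

/-- The space `ℓ²_λ(L^p)` of (classes of) functions `f` on `ℝⁿ` with
`(∑_a ‖λ_a χ_a f‖_{L^p}²)^{1/2} < ∞`. -/
noncomputable def ellTwo {n : ℕ} (lam : (Fin n → ℤ) → Set.Ioi (0 : ℝ)) (p : ℝ≥0∞)
    [Fact (1 ≤ p)] : Submodule ℂ (LZero n) where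
  carrier := {f | ellTwoNorm lam p f < ∞}
  zero_mem' := by
    change ellTwoNorm lam p 0 < ∞
    simp [ellTwoNorm_zero]
  add_mem' {f g} hf hg :=
    (ellTwoNorm_add_le lam p f g).trans_lt (ENNReal.add_lt_top.2 ⟨hf, hg⟩)
  smul_mem' c f hf := by
    change ellTwoNorm lam p (c • f) < ∞
    rw [ellTwoNorm_smul]
    exact ENNReal.mul_lt_top enorm_lt_top hf

section Normed

variable {n : ℕ} (lam : (Fin n → ℤ) → Set.Ioi (0 : ℝ)) (p : ℝ≥0∞) [Fact (1 ≤ p)]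

noncomputable instance : Norm (ellTwo lam p) where
  norm f := (ellTwoNorm lam p (f : LZero n)).toReal

theorem ellTwo_core : NormedSpace.Core ℂ (ellTwo lam p) where
  norm_nonneg _ := ENNReal.toReal_nonneg
  norm_smul c f := by
    change (ellTwoNorm lam p (c • (f : LZero n))).toReal = _
    rw [ellTwoNorm_smul, ENNReal.toReal_mul, toReal_enorm]
    rfl
  norm_triangle f g := by
    change (ellTwoNorm lam p ((f : LZero n) + g)).toReal ≤ _
    refine (ENNReal.toReal_mono (ENNReal.add_lt_top.2 ⟨f.2, g.2⟩).ne
      (ellTwoNorm_add_le lam p (f : LZero n) g)).trans (le_of_eq ?_)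
    exact ENNReal.toReal_add f.2.ne g.2.ne
  norm_eq_zero_iff f := by
    constructor
    · intro h
      have h' : (ellTwoNorm lam p (f : LZero n)).toReal = 0 := h
      rcases (ENNReal.toReal_eq_zero_iff _).1 h' with h0 | h0
      · exact Subtype.ext (eq_zero_of_ellTwoNorm lam p _ h0)
      · exact absurd h0 f.2.ne
    · rintro rfl
      change (ellTwoNorm lam p (0 : LZero n)).toReal = 0
      simp [ellTwoNorm_zero]

/-- The norm of `ℓ²_λ(L^p)` is `‖f‖ = (∑_a ‖λ_a χ_a f‖_{L^p}²)^{1/2}`. -/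
noncomputable instance : NormedAddCommGroup (ellTwo lam p) :=
  NormedAddCommGroup.ofCore (ellTwo_core lam p)

noncomputable instance : NormedSpace ℂ (ellTwo lam p) :=
  NormedSpace.ofCore (ellTwo_core lam p)

end Normed

/-- The space `ℓ^∞_λ(L^q)` of (classes of) functions `g` on `ℝⁿ` with
`sup_a ‖λ_a χ_a g‖_{L^q} < ∞`. -/
def ellInfty {n : ℕ} (lam : (Fin n → ℤ) → Set.Ioi (0 : ℝ)) (q : ℝ≥0∞) : Set (LZero n) :=
  {g | ellInftyNorm lam q g < ∞}

/-- The operator `g(Q)` of multiplication by the function `g`. -/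
noncomputable def mulOp {n : ℕ} (g : LZero n) : LZero n →ₗ[ℂ] LZero n where
  toFun f := g * f
  map_add' f₁ f₂ := by
    refine AEEqFun.ext ?_
    filter_upwards [AEEqFun.coeFn_mul g (f₁ + f₂), AEEqFun.coeFn_add f₁ f₂,
      AEEqFun.coeFn_add (g * f₁) (g * f₂), AEEqFun.coeFn_mul g f₁,
      AEEqFun.coeFn_mul g f₂] with x h1 h2 h3 h4 h5
    simp only [h1, h2, h3, h4, h5, Pi.mul_apply, Pi.add_apply, mul_add]
  map_smul' c f := by
    refine AEEqFun.ext ?_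
    filter_upwards [AEEqFun.coeFn_mul g (c • f), AEEqFun.coeFn_smul c f,
      AEEqFun.coeFn_smul c (g * f), AEEqFun.coeFn_mul g f] with x h1 h2 h3 h4
    simp only [RingHom.id_apply, h1, h2, h3, h4, Pi.mul_apply, Pi.smul_apply, smul_eq_mul,
      mul_left_comm]

end Amalgam

/-! This is Maurey's factorization by change of density, carried out on each cube.

Random signs carry the Hilbert structure of the domain over to the target. Averaging the bound for
`T` over sums `∑ ± v_j` and applying Khinchine's inequality pointwise bounds the square function `(∑
|T v_j|²)^{1/2}` by a multiple of `‖T‖ (∑ ‖v_j‖²)^{1/2}` (`squareFunction_le`).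

Fix positive `c_a` of total mass 1 and consider the `w` in `L²` with `∫_{K_a} w² ≤ c_a`. With `κ =
λ_a² c_a^{2/q}` on `K_a`, the functionals `w ↦ ∫ |Tu|² κ w^{-4/q}` are convex and lower
semicontinuous. For one finite nonnegative combination of them, the equality case of Hölder on each
cube gives an admissible `w` whose value is the square function bound
(`exists_mem_fiberBall_lintegral_le`). Minimax over this bounded closed convex set then gives one
`w` for all `u` (`exists_weight`).

Take `g = λ_a⁻¹ c_a^{-1/q} w^{2/q}` on `K_a`. The mass bound on `w` puts `g` in `ℓ^∞_λ(L^q)`, and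
the functionals become `∫ |Tu/g|²`, so `R u = Tu/g` maps into `L²`. -/

namespace Amalgam

/-! ### Minimax in a Hilbert space. -/

section Minimax

variable {E : Type*} [NormedAddCommGroup E] [InnerProductSpace ℝ E] [CompleteSpace E]

/-- A family of closed convex subsets of a Hilbert space, any finite number of which have a common
point in a fixed ball, has a common point. -/
theorem nonempty_iInter_of_closed_convex {I : Type*} (A : I → Set E) (M : ℝ)
    (hcl : ∀ i, IsClosed (A i)) (hcv : ∀ i, Convex ℝ (A i))
    (hne : ∀ s : Finset I, ∃ x ∈ ⋂ i ∈ s, A i, ‖x‖ ≤ M) : ∃ x, ∀ i, x ∈ A i := by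
  classical
  set C : Finset I → Set E := fun s => ⋂ i ∈ s, A i with hC
  have hCcl : ∀ s, IsClosed (C s) := fun s => isClosed_biInter fun i _ => hcl i
  have hCcv : ∀ s, Convex ℝ (C s) := fun s => convex_iInter₂ fun i _ => hcv i
  have hanti : ∀ s t, s ⊆ t → C t ⊆ C s := fun s t h => Set.biInter_subset_biInter_left h
  -- In place of weak compactness: the points of least norm in the finite intersections form a
  -- Cauchy net.
  have hmin : ∀ s, ∃ x ∈ C s, ∀ y ∈ C s, ‖x‖ ≤ ‖y‖ := by
    intro s
    obtain ⟨z, hz, -⟩ := hne s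
    obtain ⟨x, hx, h⟩ := exists_norm_eq_iInf_of_complete_convex ⟨z, hz⟩ (hCcl s).isComplete
      (hCcv s) 0
    refine ⟨x, hx, fun y hy => ?_⟩
    have hb : BddBelow (Set.range fun w : C s => ‖(0 : E) - w‖) :=
      ⟨0, by rintro _ ⟨w, rfl⟩; exact norm_nonneg _⟩
    have := ciInf_le hb ⟨y, hy⟩
    rw [← h] at this
    simpa using this
  choose x hx hxmin using hmin
  have hxM : ∀ s, ‖x s‖ ≤ M := fun s => by
    obtain ⟨z, hz, hzM⟩ := hne s
    exact (hxmin s z hz).trans hzM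
  have hmono : ∀ s t, s ⊆ t → ‖x s‖ ≤ ‖x t‖ := fun s t h => hxmin s _ (hanti s t h (hx t))
  set d := ⨆ s, ‖x s‖ with hd
  have hbdd : BddAbove (Set.range fun s => ‖x s‖) := ⟨M, by rintro _ ⟨s, rfl⟩; exact hxM s⟩
  have hxd : ∀ s, ‖x s‖ ≤ d := fun s => le_ciSup hbdd s
  have hd0 : 0 ≤ d := (norm_nonneg _).trans (hxd ∅)
  -- The midpoint of `x s` and `x t` lies in `C s`, so its norm is at least `‖x s‖`. The
  -- parallelogram law then gives `‖x s - x t‖² ≤ 2(‖x t‖² - ‖x s‖²)`.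
  have hest : ∀ s t, s ⊆ t → ‖x s - x t‖ ^ 2 ≤ 4 * d * (d - ‖x s‖) := by
    intro s t h
    have hm : ‖x s‖ ≤ ‖(1 / 2 : ℝ) • x s + (1 / 2 : ℝ) • x t‖ :=
      hxmin s _ (hCcv s (hx s) (hanti s t h (hx t)) (by norm_num) (by norm_num) (by norm_num))
    rw [← smul_add, norm_smul] at hm
    have hp := parallelogram_law_with_norm ℝ (x s) (x t)
    norm_num at hm
    nlinarith [hxd s, hxd t, norm_nonneg (x s), norm_nonneg (x t), norm_nonneg (x s + x t)]
  have hcau : CauchySeq x := by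
    rw [Metric.cauchySeq_iff']
    intro ε hε
    have hpos : 0 < ε ^ 2 / (4 * (d + 1)) := by positivity
    obtain ⟨s, hs⟩ := exists_lt_of_lt_ciSup (sub_lt_self d hpos)
    refine ⟨s, fun t ht => ?_⟩
    rw [dist_comm, dist_eq_norm]
    refine lt_of_pow_lt_pow_left₀ 2 hε.le ((hest s t ht).trans_lt ?_)
    have h1 : d - ‖x s‖ < ε ^ 2 / (4 * (d + 1)) := by linarith
    rw [lt_div_iff₀ (by positivity)] at h1
    nlinarith [hxd s]
  obtain ⟨y, hy⟩ := cauchySeq_tendsto_of_complete hcau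
  refine ⟨y, fun i => (hcl i).mem_of_tendsto hy ?_⟩
  filter_upwards [Filter.eventually_ge_atTop ({i} : Finset I)] with s hs
  have := hx s
  simp only [hC, Set.mem_iInter] at this
  exact this i (hs (Finset.mem_singleton_self i))

/-- Finite-dimensional minimax: a finite system of convex inequalities is solvable as soon as
every positive combination of slightly stronger ones is. -/
theorem exists_forall_le_of_forall_sum_le {V I : Type*} [AddCommGroup V] [Module ℝ V] [Fintype I]
    {K : Set V} (hK : Convex ℝ K) (Φ : I → V → ℝ≥0∞)
    (hΦ : ∀ i x y (a b : ℝ), 0 ≤ a → 0 ≤ b → a + b = 1 →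
      Φ i (a • x + b • y) ≤ ENNReal.ofReal a * Φ i x + ENNReal.ofReal b * Φ i y)
    (c d : I → ℝ) (hd : ∀ i, 0 ≤ d i) (hcd : ∀ i, d i < c i)
    (h : ∀ t : I → ℝ, (∀ i, 0 < t i) → ∃ x ∈ K,
      ∑ i, ENNReal.ofReal (t i) * Φ i x ≤ ENNReal.ofReal (∑ i, t i * d i)) :
    ∃ x ∈ K, ∀ i, Φ i x ≤ ENNReal.ofReal (c i) := by
  classical
  by_contra hcon
  -- Strict positivity of every `t i` rules out infinite values, which a zero coefficient would
  -- hide.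
  have hfin : ∀ t : I → ℝ, (∀ i, 0 < t i) → ∃ x ∈ K, (∀ i, Φ i x ≠ ∞) ∧
      ∑ i, t i * (Φ i x).toReal ≤ ∑ i, t i * d i := by
    intro t ht
    obtain ⟨x, hxK, hx⟩ := h t ht
    have hne : ∀ i, ENNReal.ofReal (t i) * Φ i x ≠ ∞ := fun i =>
      (((Finset.single_le_sum (f := fun i => ENNReal.ofReal (t i) * Φ i x)
        (fun _ _ => zero_le) (Finset.mem_univ i)).trans hx).trans_lt ENNReal.ofReal_lt_top).ne
    have hne' : ∀ i, Φ i x ≠ ∞ := fun i hi => by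
      refine hne i ?_
      rw [hi, ENNReal.mul_top]
      simpa using ht i
    refine ⟨x, hxK, hne', ?_⟩
    have := ENNReal.toReal_mono ENNReal.ofReal_ne_top hx
    rw [ENNReal.toReal_sum fun i _ => hne i, ENNReal.toReal_ofReal
      (Finset.sum_nonneg fun i _ => mul_nonneg (ht i).le (hd i))] at this
    simpa only [ENNReal.toReal_mul, ENNReal.toReal_ofReal (ht _).le] using this
  -- Attainable vectors of bounds, to be separated by a hyperplane from the open orthant below `c`.
  set S : Set (I → ℝ) := {y | ∃ x ∈ K, ∀ i, Φ i x ≤ ENNReal.ofReal (y i) ∧ 0 ≤ y i} with hS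
  set O : Set (I → ℝ) := {y | ∀ i, y i < c i} with hO
  have hScv : Convex ℝ S := by
    rintro y ⟨x, hxK, hx⟩ y' ⟨x', hxK', hx'⟩ a b ha hb hab
    refine ⟨a • x + b • x', hK hxK hxK' ha hb hab, fun i => ⟨?_, ?_⟩⟩
    · refine (hΦ i x x' a b ha hb hab).trans ?_
      have h1 := (hx i).2
      have h2 := (hx' i).2
      simp only [Pi.add_apply, Pi.smul_apply, smul_eq_mul]
      rw [ENNReal.ofReal_add (by positivity) (by positivity), ENNReal.ofReal_mul ha,
        ENNReal.ofReal_mul hb]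
      gcongr
      exacts [(hx i).1, (hx' i).1]
    · have h1 := (hx i).2
      have h2 := (hx' i).2
      simp only [Pi.add_apply, Pi.smul_apply, smul_eq_mul]
      positivity
  have hOeq : O = Set.univ.pi fun i => Set.Iio (c i) := by ext; simp [hO]
  have hOcv : Convex ℝ O := by
    rw [hOeq]; exact convex_pi fun i _ => convex_Iio _
  have hOop : IsOpen O := by
    rw [hOeq]; exact isOpen_set_pi Set.finite_univ fun i _ => isOpen_Iio
  have hdisj : Disjoint O S := by
    rw [Set.disjoint_left]
    rintro y hy ⟨x, hxK, hx⟩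
    exact hcon ⟨x, hxK, fun i => (hx i).1.trans (ENNReal.ofReal_le_ofReal (hy i).le)⟩
  obtain ⟨f, s, hfO, hfS⟩ := geometric_hahn_banach_open hOcv hOop hScv hdisj
  set t : I → ℝ := fun i => f (Pi.single i 1) with ht
  have hf : ∀ y, f y = ∑ i, t i * y i := by
    intro y
    conv_lhs => rw [pi_eq_sum_univ' y]
    simp [ht, mul_comm]
  have hdO : d ∈ O := hcd
  have hfd := hfO d hdO
  -- `O` is unbounded below in each coordinate while `f < s` on it. If `t i < 0`, lowering
  -- coordinate `i` of `d` by `(f d - s) / t i` stays in `O` and raises `f` to exactly `s`.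
  have ht0 : ∀ i, 0 ≤ t i := by
    intro i
    by_contra hi
    push Not at hi
    have hN : 0 < (f d - s) / t i := div_pos_of_neg_of_neg (by linarith) hi
    have h1 : d - ((f d - s) / t i) • Pi.single i (1 : ℝ) ∈ O := by
      intro j
      by_cases hj : j = i
      · subst hj
        simp only [Pi.sub_apply, Pi.smul_apply, Pi.single_eq_same, smul_eq_mul, mul_one]
        linarith [hcd j]
      · simpa [Pi.single_eq_of_ne hj] using hcd j
    have h2 := hfO _ h1
    rw [map_sub, map_smul, smul_eq_mul] at h2
    change f d - (f d - s) / t i * t i < s at h2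
    rw [div_mul_cancel₀ _ hi.ne] at h2
    linarith
  set D := ∑ i, d i with hD
  have hD0 : 0 ≤ D := Finset.sum_nonneg fun i _ => hd i
  -- Separation gives only `t ≥ 0`, so the coefficients are made positive by adding `η`. This costs
  -- `η * D`, strictly less than the gap `s - f d = η * (D + 1)`.
  set η := (s - f d) / (D + 1) with hη
  have hη0 : 0 < η := div_pos (by linarith) (by linarith)
  obtain ⟨x, hxK, hxne, hx⟩ := hfin (fun i => t i + η) fun i => by linarith [ht0 i]
  have hxS : (fun i => (Φ i x).toReal) ∈ S :=
    ⟨x, hxK, fun i => ⟨by rw [ENNReal.ofReal_toReal (hxne i)], ENNReal.toReal_nonneg⟩⟩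
  have h1 := hfS _ hxS
  have h2 : f (fun i => (Φ i x).toReal) ≤ ∑ i, (t i + η) * (Φ i x).toReal := by
    rw [hf]
    gcongr with i
    linarith
  have h3 : ∑ i, (t i + η) * d i = f d + η * D := by
    rw [hf, hD, Finset.mul_sum, ← Finset.sum_add_distrib]
    simp only [add_mul]
  have h4 : η * (D + 1) = s - f d := div_mul_cancel₀ _ (by linarith)
  nlinarith

/-- Minimax for convex lower semicontinuous functionals on a bounded closed convex subset of a
Hilbert space. -/
theorem exists_forall_le_of_forall_finset_sum_le {I : Type*}
    {K : Set E} (hK : Convex ℝ K) (hKcl : IsClosed K) (M : ℝ) (hKM : ∀ x ∈ K, ‖x‖ ≤ M)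
    (Φ : I → E → ℝ≥0∞)
    (hΦ : ∀ i x y (a b : ℝ), 0 ≤ a → 0 ≤ b → a + b = 1 →
      Φ i (a • x + b • y) ≤ ENNReal.ofReal a * Φ i x + ENNReal.ofReal b * Φ i y)
    (hΦcl : ∀ i (r : ℝ≥0∞), IsClosed {x | Φ i x ≤ r})
    (c d : I → ℝ) (hd : ∀ i, 0 ≤ d i) (hcd : ∀ i, d i < c i)
    (h : ∀ (s : Finset I) (t : I → ℝ), (∀ i, 0 ≤ t i) → ∃ x ∈ K,
      ∑ i ∈ s, ENNReal.ofReal (t i) * Φ i x ≤ ENNReal.ofReal (∑ i ∈ s, t i * d i)) :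
    ∃ x ∈ K, ∀ i, Φ i x ≤ ENNReal.ofReal (c i) := by
  classical
  have key := nonempty_iInter_of_closed_convex
    (fun i => K ∩ {x | Φ i x ≤ ENNReal.ofReal (c i)}) M (fun i => hKcl.inter (hΦcl i _))
    (fun i => hK.inter ?_) ?_
  · obtain ⟨x, hx⟩ := key
    -- An intersection over an empty index type does not place the point in `K`.
    rcases isEmpty_or_nonempty I with hI | ⟨⟨i⟩⟩
    · obtain ⟨y, hy, -⟩ := h ∅ (fun _ => 0) fun _ => le_rfl
      exact ⟨y, hy, fun i => (hI.false i).elim⟩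
    · exact ⟨x, (hx i).1, fun j => (hx j).2⟩
  · intro x hx y hy a b ha hb hab
    refine (hΦ i x y a b ha hb hab).trans ?_
    calc _ ≤ ENNReal.ofReal a * ENNReal.ofReal (c i) + ENNReal.ofReal b * ENNReal.ofReal (c i) := by
          gcongr
          exacts [hx, hy]
      _ = _ := by rw [← add_mul, ← ENNReal.ofReal_add ha hb, hab]; simp
  · intro s
    obtain ⟨x, hxK, hx⟩ := exists_forall_le_of_forall_sum_le (I := s) hK (fun i => Φ i)
      (fun i => hΦ i) (fun i => c i) (fun i => d i) (fun i => hd i) (fun i => hcd i) (by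
        intro t ht
        obtain ⟨x, hxK, hx⟩ := h s (fun i => if hi : i ∈ s then t ⟨i, hi⟩ else 0) (fun i => by
          split_ifs
          exacts [(ht _).le, le_rfl])
        refine ⟨x, hxK, ?_⟩
        rw [← Finset.sum_coe_sort s, ← Finset.sum_coe_sort s] at hx
        simpa using hx)
    refine ⟨x, ?_, hKM x hxK⟩
    simp only [Set.mem_iInter]
    exact fun i hi => ⟨hxK, hx ⟨i, hi⟩⟩

end Minimax

/-! ### Khinchine's inequality by second and fourth moments. -/

section Khinchine

/-- The signed sum `∑ ± v_j` for a choice of signs. -/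
def signSum {V : Type*} [AddCommGroup V] {m : ℕ} (v : Fin m → V) (ε : Fin m → Bool) : V :=
  ∑ j, if ε j then v j else -v j

/-- Splitting off the first sign is the induction step for both moment computations. -/
theorem sum_signSum_succ {V : Type*} [AddCommGroup V] {m : ℕ} (v : Fin (m + 1) → V) (φ : V → ℝ) :
    ∑ ε, φ (signSum v ε) = ∑ ε, (φ (v 0 + signSum (fun j => v j.succ) ε) +
      φ (-v 0 + signSum (fun j => v j.succ) ε)) := by
  rw [← (Fin.consEquiv fun _ => Bool).sum_comp, Fintype.sum_prod_type]
  simp [signSum, Fin.sum_univ_succ, Fin.consEquiv, Finset.sum_add_distrib]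

variable {V : Type*} [NormedAddCommGroup V] [InnerProductSpace ℝ V]

theorem sum_norm_sq_signSum {m : ℕ} (v : Fin m → V) :
    ∑ ε, ‖signSum v ε‖ ^ 2 = 2 ^ m * ∑ j, ‖v j‖ ^ 2 := by
  induction m with
  | zero => simp [signSum]
  | succ m ih =>
    rw [sum_signSum_succ v (fun x => ‖x‖ ^ 2), Fin.sum_univ_succ]
    have : ∀ ε, ‖v 0 + signSum (fun j => v j.succ) ε‖ ^ 2 +
        ‖-v 0 + signSum (fun j => v j.succ) ε‖ ^ 2 =
        2 * ‖v 0‖ ^ 2 + 2 * ‖signSum (fun j => v j.succ) ε‖ ^ 2 := fun ε => by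
      rw [norm_add_sq_real, norm_add_sq_real, norm_neg, inner_neg_left]
      ring
    simp only [this, Finset.sum_add_distrib, ← Finset.mul_sum, ih (fun j => v j.succ)]
    simp
    ring

/-- Adding the two values of the first sign cancels the odd terms in the inner product, and
Cauchy–Schwarz bounds its square. The cross term `12 ‖v 0‖² σ` is exactly what the constant 3
allows. -/
theorem sum_norm_pow_four_signSum_le {m : ℕ} (v : Fin m → V) :
    ∑ ε, ‖signSum v ε‖ ^ 4 ≤ 2 ^ m * (3 * (∑ j, ‖v j‖ ^ 2) ^ 2) := by
  induction m with
  | zero => simp [signSum]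
  | succ m ih =>
    rw [sum_signSum_succ v (fun x => ‖x‖ ^ 4), Fin.sum_univ_succ]
    set w := fun j : Fin m => v j.succ with hw
    have key : ∀ ε, ‖v 0 + signSum w ε‖ ^ 4 + ‖-v 0 + signSum w ε‖ ^ 4 ≤
        2 * ‖v 0‖ ^ 4 + 12 * ‖v 0‖ ^ 2 * ‖signSum w ε‖ ^ 2 + 2 * ‖signSum w ε‖ ^ 4 := fun ε => by
      have h1 : ∀ x : V, ‖x‖ ^ 4 = (‖x‖ ^ 2) ^ 2 := fun x => by ring
      rw [h1 (_ + _), h1 (_ + _), norm_add_sq_real, norm_add_sq_real, norm_neg, inner_neg_left]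
      have h2 := abs_real_inner_le_norm (v 0) (signSum w ε)
      have h3 : inner ℝ (v 0) (signSum w ε) ^ 2 ≤ (‖v 0‖ * ‖signSum w ε‖) ^ 2 := by
        rw [← sq_abs]; gcongr
      nlinarith
    refine (Finset.sum_le_sum fun ε _ => key ε).trans ?_
    simp only [Finset.sum_add_distrib, ← Finset.mul_sum, sum_norm_sq_signSum w]
    have := ih w
    simp only [Finset.sum_const, Finset.card_univ, Fintype.card_pi, Fintype.card_bool,
      Finset.prod_const, Fintype.card_fin, nsmul_eq_mul, Nat.cast_pow, Nat.cast_ofNat]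
    set σ := ∑ j, ‖w j‖ ^ 2
    have h4 : (0 : ℝ) ≤ 2 ^ m * ‖v 0‖ ^ 4 := by positivity
    rw [pow_succ (2 : ℝ) m]
    nlinarith

/-- Khinchine's inequality for `p`-th moments, `0 < p ≤ 2`. -/
theorem khinchine {m : ℕ} (v : Fin m → V) {p : ℝ} (hp0 : 0 < p) (hp2 : p ≤ 2) :
    (∑ j, ‖v j‖ ^ 2) ^ (p / 2) ≤ 12 * ((2 ^ m)⁻¹ * ∑ ε, ‖signSum v ε‖ ^ p) := by
  set S := ∑ j, ‖v j‖ ^ 2 with hS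
  have hS0 : 0 ≤ S := by positivity
  rcases hS0.eq_or_lt with h0 | hpos
  · rw [← h0, Real.zero_rpow (by positivity)]
    positivity
  -- This elementary inequality replaces Hölder interpolation between moments and gives a constant
  -- independent of `p`.
  have hpt : ∀ t : ℝ, 0 ≤ t → t ^ 2 - t ^ 4 ≤ t ^ p := by
    intro t ht
    rcases le_total t 1 with h | h
    · have : t ^ (2 : ℝ) ≤ t ^ p := by
        rcases ht.eq_or_lt with rfl | h0
        · rw [Real.zero_rpow two_ne_zero]; positivity
        · exact Real.rpow_le_rpow_of_exponent_ge h0 h hp2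
      rw [Real.rpow_two] at this
      have : 0 ≤ t ^ 4 := by positivity
      linarith
    · have h1 : t ^ 2 ≤ t ^ 4 := pow_le_pow_right₀ h (by norm_num)
      have : 0 ≤ t ^ p := by positivity
      linarith
  -- At this scale the mean square is `1/6` and the mean fourth power is at most `3/36`, leaving
  -- `1/12`.
  set ρ := Real.sqrt (6 * S) with hρ
  have hρ0 : 0 < ρ := by positivity
  have hρ2 : ρ ^ 2 = 6 * S := Real.sq_sqrt (by positivity)
  have h1 : ∑ ε, ((‖signSum v ε‖ / ρ) ^ 2 - (‖signSum v ε‖ / ρ) ^ 4) ≤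
      ∑ ε, (‖signSum v ε‖ / ρ) ^ p := Finset.sum_le_sum fun ε _ => hpt _ (by positivity)
  rw [Finset.sum_sub_distrib] at h1
  simp only [div_pow, Real.div_rpow (norm_nonneg _) hρ0.le] at h1
  rw [← Finset.sum_div, ← Finset.sum_div, ← Finset.sum_div, sum_norm_sq_signSum] at h1
  have h2 := sum_norm_pow_four_signSum_le v
  have hρ4 : ρ ^ 4 = 36 * S ^ 2 := by
    rw [show ρ ^ 4 = (ρ ^ 2) ^ 2 by ring, hρ2]; ring
  rw [hρ2, hρ4, ← hS] at h1
  rw [← hS] at h2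
  have h3 : (2 : ℝ) ^ m / 12 ≤ (∑ ε, ‖signSum v ε‖ ^ p) / ρ ^ p := by
    refine le_trans ?_ h1
    have : (∑ ε, ‖signSum v ε‖ ^ 4) / (36 * S ^ 2) ≤ 2 ^ m / 12 := by
      rw [div_le_iff₀ (by positivity)]
      nlinarith
    have h5 : 2 ^ m * S / (6 * S) = 2 ^ m / 6 := by field_simp
    rw [h5]
    linarith
  have h6 : ρ ^ p = 6 ^ (p / 2) * S ^ (p / 2) := by
    rw [hρ, Real.sqrt_eq_rpow, ← Real.rpow_mul (by positivity), Real.mul_rpow (by norm_num) hS0]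
    congr 2 <;> ring
  have h7 : (1 : ℝ) ≤ 6 ^ (p / 2) := Real.one_le_rpow (by norm_num) (by positivity)
  rw [le_div_iff₀ (by positivity), h6] at h3
  have h8 : 0 ≤ S ^ (p / 2) := by positivity
  have h9 : S ^ (p / 2) ≤ 6 ^ (p / 2) * S ^ (p / 2) := by nlinarith
  rw [inv_mul_eq_div, ← mul_div_assoc, le_div_iff₀ (by positivity)]
  have : (0 : ℝ) < 2 ^ m := by positivity
  nlinarith

end Khinchine

/-! ### Convexity and lower semicontinuity of weighted integrals. -/

section Functional

/-- On positive reals this is `exp` after `-r * log`, both convex, with `exp` increasing.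
Nonpositive arguments have value `∞`, so the bound is trivial there once zero coefficients are set
aside, because `0 * ∞ = 0`. -/
theorem ofReal_rpow_neg_convex {r : ℝ} (hr : 0 < r) (x y a b : ℝ) (ha : 0 ≤ a) (hb : 0 ≤ b)
    (hab : a + b = 1) :
    ENNReal.ofReal (a * x + b * y) ^ (-r) ≤ ENNReal.ofReal a * ENNReal.ofReal x ^ (-r) +
      ENNReal.ofReal b * ENNReal.ofReal y ^ (-r) := by
  rcases ha.eq_or_lt with rfl | ha0
  · obtain rfl : b = 1 := by linarith
    simp
  rcases hb.eq_or_lt with rfl | hb0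
  · obtain rfl : a = 1 := by linarith
    simp
  have htop : ∀ z : ℝ, z ≤ 0 → ENNReal.ofReal z ^ (-r) = ∞ := fun z hz => by
    rw [ENNReal.ofReal_of_nonpos hz, ENNReal.zero_rpow_of_neg (by linarith)]
  rcases le_or_gt x 0 with hx | hx
  · rw [htop x hx, ENNReal.mul_top (by simpa using ha0)]
    simp
  rcases le_or_gt y 0 with hy | hy
  · rw [htop y hy, ENNReal.mul_top (by simpa using hb0)]
    simp
  have hxy : 0 < a * x + b * y := by positivity
  rw [ENNReal.ofReal_rpow_of_pos hxy, ENNReal.ofReal_rpow_of_pos hx, ENNReal.ofReal_rpow_of_pos hy,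
    ← ENNReal.ofReal_mul ha, ← ENNReal.ofReal_mul hb, ← ENNReal.ofReal_add (by positivity)
    (by positivity)]
  refine ENNReal.ofReal_le_ofReal ?_
  have hl := strictConcaveOn_log_Ioi.concaveOn.2 (Set.mem_Ioi.2 hx) (Set.mem_Ioi.2 hy) ha hb hab
  have he := convexOn_exp.2 (Set.mem_univ (Real.log x * -r)) (Set.mem_univ (Real.log y * -r))
    ha hb hab
  simp only [smul_eq_mul] at hl he
  rw [Real.rpow_def_of_pos hxy, Real.rpow_def_of_pos hx, Real.rpow_def_of_pos hy]
  refine le_trans (Real.exp_le_exp.2 ?_) he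
  nlinarith

theorem enorm_sq_convex (x y a b : ℝ) (ha : 0 ≤ a) (hb : 0 ≤ b) (hab : a + b = 1) :
    ‖a * x + b * y‖ₑ ^ 2 ≤ ENNReal.ofReal a * ‖x‖ₑ ^ 2 + ENNReal.ofReal b * ‖y‖ₑ ^ 2 := by
  have h : ∀ z : ℝ, ‖z‖ₑ ^ 2 = ENNReal.ofReal (z ^ 2) := fun z => by
    rw [Real.enorm_eq_ofReal_abs, ← ENNReal.ofReal_pow (abs_nonneg z), sq_abs]
  rw [h, h, h, ← ENNReal.ofReal_mul ha, ← ENNReal.ofReal_mul hb, ← ENNReal.ofReal_add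
    (by positivity) (by positivity)]
  refine ENNReal.ofReal_le_ofReal ?_
  obtain rfl : b = 1 - a := by linarith
  nlinarith [mul_nonneg (mul_nonneg ha hb) (sq_nonneg (x - y))]

variable {X : Type*} [MeasurableSpace X] {μ : Measure X}

/-- Multiplying a pointwise convex function by a density and integrating gives a convex
functional. -/
theorem lintegral_mul_convex (G : X → ℝ≥0∞) (hG : Measurable G) (ψ : ℝ → ℝ≥0∞)
    (hψm : Measurable ψ)
    (hψ : ∀ x y a b : ℝ, 0 ≤ a → 0 ≤ b → a + b = 1 →
      ψ (a * x + b * y) ≤ ENNReal.ofReal a * ψ x + ENNReal.ofReal b * ψ y)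
    (v w : Lp ℝ 2 μ) (a b : ℝ) (ha : 0 ≤ a) (hb : 0 ≤ b) (hab : a + b = 1) :
    ∫⁻ x, G x * ψ ((a • v + b • w : Lp ℝ 2 μ) x) ∂μ ≤
      ENNReal.ofReal a * ∫⁻ x, G x * ψ (v x) ∂μ + ENNReal.ofReal b * ∫⁻ x, G x * ψ (w x) ∂μ := by
  have hm : ∀ u : Lp ℝ 2 μ, Measurable fun x => G x * ψ (u x) := fun u =>
    hG.mul (hψm.comp (Lp.stronglyMeasurable u).measurable)
  rw [← lintegral_const_mul _ (hm v), ← lintegral_const_mul _ (hm w),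
    ← lintegral_add_left ((hm v).const_mul _)]
  refine lintegral_mono_ae ?_
  filter_upwards [Lp.coeFn_add (a • v) (b • w), Lp.coeFn_smul a v, Lp.coeFn_smul b w]
    with x h1 h2 h3
  rw [h1, Pi.add_apply, h2, h3, Pi.smul_apply, Pi.smul_apply, smul_eq_mul, smul_eq_mul]
  calc _ ≤ G x * (ENNReal.ofReal a * ψ (v x) + ENNReal.ofReal b * ψ (w x)) := by
        gcongr
        exact hψ _ _ _ _ ha hb hab
    _ = _ := by ring

/-- Sublevel sets of `w ↦ ∫ G ψ(w)` are closed in `L²`. -/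
theorem isClosed_lintegral_mul_le (G : X → ℝ≥0∞) (hG : Measurable G) (hGt : ∀ x, G x ≠ ∞)
    (ψ : ℝ → ℝ≥0∞) (hψ : Continuous ψ) (r : ℝ≥0∞) :
    IsClosed {w : Lp ℝ 2 μ | ∫⁻ x, G x * ψ (w x) ∂μ ≤ r} := by
  refine IsSeqClosed.isClosed fun w w₀ hw hlim => ?_
  -- An almost everywhere convergent subsequence makes Fatou's lemma available.
  obtain ⟨k, -, hk⟩ := (tendstoInMeasure_of_tendsto_Lp hlim).exists_seq_tendsto_ae
  have hm : ∀ u : Lp ℝ 2 μ, Measurable fun x => G x * ψ (u x) := fun u =>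
    hG.mul (hψ.measurable.comp (Lp.stronglyMeasurable u).measurable)
  calc ∫⁻ x, G x * ψ (w₀ x) ∂μ
      ≤ ∫⁻ x, Filter.liminf (fun j => G x * ψ (w (k j) x)) Filter.atTop ∂μ := by
        refine lintegral_mono_ae ?_
        filter_upwards [hk] with x hx
        exact (ENNReal.Tendsto.const_mul ((hψ.tendsto _).comp hx) (Or.inr (hGt x))).liminf_eq.ge
    _ ≤ Filter.liminf (fun j => ∫⁻ x, G x * ψ (w (k j) x) ∂μ) Filter.atTop :=
        lintegral_liminf_le fun j => hm _
    _ ≤ r := by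
        refine Filter.liminf_le_of_frequently_le' (Filter.Frequently.of_forall fun j => hw (k j))

end Functional

/-! ### Weights with prescribed mass on each fibre. -/

section Weights

variable {X ι : Type*} [MeasurableSpace X] {μ : Measure X} [MeasurableSpace ι]
  [MeasurableSingletonClass ι]

/-- The square-integrable functions whose squares have prescribed bounds for their integrals over
the fibres of `π`. -/
def fiberBall (μ : Measure X) (π : X → ι) (c : ι → NNReal) : Set (Lp ℝ 2 μ) :=
  {w | ∀ a, ∫⁻ x in π ⁻¹' {a}, ‖w x‖ₑ ^ 2 ∂μ ≤ c a}

/-- Each constraint takes the form `∫ G ψ(w) ≤ r`, to which the convexity and closedness results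
apply. -/
theorem fiberBall_eq {π : X → ι} (hπ : Measurable π) (c : ι → NNReal) :
    fiberBall μ π c =
      ⋂ a, {w | ∫⁻ x, (π ⁻¹' {a}).indicator (fun _ => 1) x * ‖w x‖ₑ ^ 2 ∂μ ≤ c a} := by
  ext w
  simp only [fiberBall, Set.mem_ofPred_eq, Set.mem_iInter]
  refine forall_congr' fun a => ?_
  rw [← lintegral_indicator (hπ (measurableSet_singleton a))]
  have : ∀ x, (π ⁻¹' {a}).indicator (fun _ => 1) x * ‖w x‖ₑ ^ 2 =
      (π ⁻¹' {a}).indicator (fun x => ‖w x‖ₑ ^ 2) x := fun x => by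
    by_cases h : x ∈ π ⁻¹' {a}
    · rw [Set.indicator_of_mem h, Set.indicator_of_mem h, one_mul]
    · rw [Set.indicator_of_notMem h, Set.indicator_of_notMem h, zero_mul]
  simp only [this]

theorem convex_fiberBall {π : X → ι} (hπ : Measurable π) (c : ι → NNReal) :
    Convex ℝ (fiberBall μ π c) := by
  rw [fiberBall_eq hπ]
  refine convex_iInter fun i v hv w hw a b ha hb hab => ?_
  refine (lintegral_mul_convex _ (measurable_const.indicator (hπ (measurableSet_singleton i)))
    (fun y => ‖y‖ₑ ^ 2) (by fun_prop) enorm_sq_convex v w a b ha hb hab).trans ?_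
  calc _ ≤ ENNReal.ofReal a * c i + ENNReal.ofReal b * c i := by
        gcongr
        exacts [hv, hw]
    _ = _ := by rw [← add_mul, ← ENNReal.ofReal_add ha hb, hab]; simp

theorem isClosed_fiberBall {π : X → ι} (hπ : Measurable π) (c : ι → NNReal) :
    IsClosed (fiberBall μ π c) := by
  rw [fiberBall_eq hπ]
  refine isClosed_iInter fun i => isClosed_lintegral_mul_le _
    (measurable_const.indicator (hπ (measurableSet_singleton i))) (fun x => ?_)
    (fun y => ‖y‖ₑ ^ 2) (by fun_prop) _
  by_cases h : x ∈ π ⁻¹' {i}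
  · simp [Set.indicator_of_mem h]
  · simp [Set.indicator_of_notMem h]

variable [Countable ι]

theorem lintegral_eq_tsum_fiber {π : X → ι} (hπ : Measurable π) (f : X → ℝ≥0∞) :
    ∫⁻ x, f x ∂μ = ∑' a, ∫⁻ x in π ⁻¹' {a}, f x ∂μ := by
  rw [← lintegral_iUnion (fun a => hπ (measurableSet_singleton a))
    (fun a b h => Disjoint.preimage _ (by simpa using h))]
  have : ⋃ a, π ⁻¹' {a} = Set.univ := by ext; simp
  rw [this, Measure.restrict_univ]

theorem norm_le_one_of_mem_fiberBall {π : X → ι} (hπ : Measurable π) {c : ι → NNReal}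
    (hc : ∑' a, (c a : ℝ≥0∞) ≤ 1) {w : Lp ℝ 2 μ} (hw : w ∈ fiberBall μ π c) : ‖w‖ ≤ 1 := by
  have h : ∫⁻ x, ‖w x‖ₑ ^ 2 ∂μ ≤ 1 := by
    rw [lintegral_eq_tsum_fiber hπ]
    exact (ENNReal.tsum_le_tsum hw).trans hc
  rw [Lp.norm_def]
  refine ENNReal.toReal_le_of_le_ofReal zero_le_one ?_
  rw [eLpNorm_eq_lintegral_rpow_enorm_toReal two_ne_zero ENNReal.ofNat_ne_top]
  simp only [ENNReal.toReal_ofNat, ENNReal.rpow_two, ENNReal.ofReal_one]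
  exact (ENNReal.rpow_le_rpow h (by norm_num)).trans (by simp)

/-- The weight in `fiberBall` that is adapted to a given function `F`. -/
theorem exists_mem_fiberBall_lintegral_le {π : X → ι} (hπ : Measurable π) {c : ι → NNReal}
    (hc0 : ∀ a, 0 < c a) (hc : ∑' a, (c a : ℝ≥0∞) ≤ 1) {p q : ℝ} (hp : 0 < p) (hq : 0 < q)
    (hpq : 1 / p = 1 / 2 + 1 / q) (F : X → ℝ≥0∞) (hF : Measurable F) (hFt : ∀ x, F x ≠ ∞)
    (l : ι → ℝ≥0∞) :
    ∃ w ∈ fiberBall μ π c,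
      ∫⁻ x, F x * (l (π x) * (c (π x) : ℝ≥0∞) ^ (2 / q)) * ENNReal.ofReal (w x) ^ (-(4 / q)) ∂μ ≤
        ∑' a, l a * (∫⁻ x in π ⁻¹' {a}, F x ^ (p / 2) ∂μ) ^ (2 / p) := by
  set J : ι → ℝ≥0∞ := fun a => ∫⁻ x in π ⁻¹' {a}, F x ^ (p / 2) ∂μ with hJ
  -- The equality case of Hölder: `W²` is proportional to `F^{p/2}` on each fibre and normalised to
  -- mass at most `c a`. Then `F * W^{-4/q}` is again proportional to `F^{p/2}`, since `1 - p/q =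
  -- p/2`.
  set W : X → ℝ≥0∞ := fun x => (c (π x) * F x ^ (p / 2) * (J (π x))⁻¹) ^ (1 / 2 : ℝ) with hW
  have hJm : Measurable fun x => J (π x) := (Measurable.of_discrete (f := J)).comp hπ
  have hcm : Measurable fun x => (c (π x) : ℝ≥0∞) :=
    (Measurable.of_discrete (f := fun a => (c a : ℝ≥0∞))).comp hπ
  have hWm : Measurable W := by
    simp only [hW]
    exact ((hcm.mul (hF.pow_const _)).mul hJm.inv).pow_const _
  have hWsq : ∀ x, W x ^ 2 = c (π x) * F x ^ (p / 2) * (J (π x))⁻¹ := fun x => by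
    rw [hW, ← ENNReal.rpow_natCast, ← ENNReal.rpow_mul]; norm_num
  have hWint : ∀ a, ∫⁻ x in π ⁻¹' {a}, W x ^ 2 ∂μ ≤ c a := by
    intro a
    have : ∫⁻ x in π ⁻¹' {a}, W x ^ 2 ∂μ =
        ∫⁻ x in π ⁻¹' {a}, (c a * (J a)⁻¹) * F x ^ (p / 2) ∂μ := by
      refine setLIntegral_congr_fun (hπ (measurableSet_singleton a)) fun x hx => ?_
      have hx' : π x = a := hx
      change W x ^ 2 = _
      rw [hWsq, hx']
      ring
    rw [this, lintegral_const_mul _ (hF.pow_const _), mul_assoc]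
    refine (mul_le_mul_right (ENNReal.inv_mul_le_one (J a)) _).trans (by simp)
  have hWtot : ∫⁻ x, W x ^ 2 ∂μ ≤ 1 := by
    rw [lintegral_eq_tsum_fiber hπ]
    exact (ENNReal.tsum_le_tsum hWint).trans hc
  have hWfin : ∀ᵐ x ∂μ, W x < ∞ := by
    filter_upwards [ae_lt_top (hWm.pow_const 2) (hWtot.trans_lt ENNReal.one_lt_top).ne] with x hx
    simpa using hx
  have hle : ∀ x, ‖(W x).toReal‖ₑ ≤ W x := fun x => by
    rw [Real.enorm_eq_ofReal ENNReal.toReal_nonneg]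
    exact ENNReal.ofReal_toReal_le
  have hmem : MemLp (fun x => (W x).toReal) 2 μ := by
    refine ⟨hWm.ennreal_toReal.aestronglyMeasurable, ?_⟩
    rw [eLpNorm_lt_top_iff_lintegral_rpow_enorm_lt_top two_ne_zero ENNReal.ofNat_ne_top]
    simp only [ENNReal.toReal_ofNat, ENNReal.rpow_two]
    refine lt_of_le_of_lt (lintegral_mono fun x => ?_) (hWtot.trans_lt ENNReal.one_lt_top)
    gcongr
    exact hle x
  refine ⟨hmem.toLp _, fun a => le_trans (lintegral_mono_ae ?_) (hWint a), ?_⟩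
  · filter_upwards [ae_restrict_of_ae hmem.coeFn_toLp] with x hx
    rw [hx]
    gcongr
    exact hle x
  rw [lintegral_eq_tsum_fiber hπ]
  refine ENNReal.tsum_le_tsum fun a => ?_
  have hJ0 : J a = 0 → ∀ᵐ x ∂μ.restrict (π ⁻¹' {a}), F x = 0 := fun h => by
    rw [hJ, lintegral_eq_zero_iff (hF.pow_const _)] at h
    filter_upwards [h] with x hx
    simpa [hp, (half_pos hp).not_gt] using hx
  have hexp : 2 / p = 1 + 2 / q := by
    have : 2 / p = 2 * (1 / p) := by ring
    rw [this, hpq]; ring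
  have hexp' : p / 2 + p / q = 1 := by
    have : p / 2 + p / q = p * (1 / 2 + 1 / q) := by ring
    rw [this, ← hpq]
    field_simp
  change _ ≤ l a * J a ^ (2 / p)
  -- The normalisation degenerates when `J a = 0`, but then `F` vanishes almost everywhere on the
  -- fibre.
  rcases eq_or_ne (J a) 0 with h0 | h0
  · refine le_trans (le_of_eq ?_) zero_le
    refine lintegral_eq_zero_of_ae_eq_zero ?_
    filter_upwards [hJ0 h0] with x hx
    simp [hx]
  calc _ ≤ ∫⁻ x in π ⁻¹' {a}, (l a * J a ^ (2 / q)) * F x ^ (p / 2) ∂μ := by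
        refine lintegral_mono_ae ?_
        filter_upwards [ae_restrict_of_ae hmem.coeFn_toLp, ae_restrict_of_ae hWfin,
          ae_restrict_mem (hπ (measurableSet_singleton a))] with x h1 h2 h3
        have h3' : π x = a := h3
        rcases eq_or_ne (F x) 0 with hF0 | hF0
        · simp [hF0]
        have hc' : (c a : ℝ≥0∞) ≠ 0 := by simpa using (hc0 a).ne'
        have hA : F x ^ (p / 2) ≠ 0 := by simp [hF0, hFt x]
        have hA' : F x ^ (p / 2) ≠ ∞ := by simp [hF0, hFt x]
        have hJi : (J a)⁻¹ ≠ ∞ := by simpa using h0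
        have hWx : W x ^ (-(4 / q)) =
            (c a : ℝ≥0∞) ^ (-(2 / q)) * F x ^ (-(p / q)) * J a ^ (2 / q) := by
          rw [hW]
          simp only [h3']
          rw [← ENNReal.rpow_mul, ENNReal.mul_rpow_of_ne_top
            (ENNReal.mul_ne_top ENNReal.coe_ne_top hA') hJi,
            ENNReal.mul_rpow_of_ne_top ENNReal.coe_ne_top hA', ← ENNReal.rpow_mul,
            ENNReal.inv_rpow, ← ENNReal.rpow_neg]
          congr 2 <;> ring_nf
        rw [h1, ENNReal.ofReal_toReal h2.ne, hWx, h3']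
        have e1 : (c a : ℝ≥0∞) ^ (2 / q) * (c a : ℝ≥0∞) ^ (-(2 / q)) = 1 := by
          rw [← ENNReal.rpow_add _ _ hc' ENNReal.coe_ne_top, add_neg_cancel, ENNReal.rpow_zero]
        have e2 : F x * F x ^ (-(p / q)) = F x ^ (p / 2) := by
          conv_lhs => rw [← ENNReal.rpow_one (F x), ← ENNReal.rpow_mul]
          rw [← ENNReal.rpow_add _ _ hF0 (hFt x)]
          congr 1
          linarith
        rw [← e2]
        refine le_of_eq ?_
        calc _ = l a * J a ^ (2 / q) * (F x * F x ^ (-(p / q))) *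
              ((c a : ℝ≥0∞) ^ (2 / q) * (c a : ℝ≥0∞) ^ (-(2 / q))) := by ring
          _ = _ := by rw [e1, mul_one]
    _ = l a * J a ^ (2 / p) := by
        rw [lintegral_const_mul _ (hF.pow_const _), mul_assoc, hexp, add_comm,
          ENNReal.rpow_add_of_nonneg _ _ (by positivity) zero_le_one, ENNReal.rpow_one]

end Weights

theorem khinchine_enorm {V : Type*} [NormedAddCommGroup V] [InnerProductSpace ℝ V] {m : ℕ}
    (v : Fin m → V) {p : ℝ} (hp0 : 0 < p) (hp2 : p ≤ 2) :
    (∑ j, ‖v j‖ₑ ^ 2) ^ (p / 2) ≤ 12 * ((2 ^ m)⁻¹ * ∑ ε, ‖signSum v ε‖ₑ ^ p) := by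
  have h := ENNReal.ofReal_le_ofReal (khinchine v hp0 hp2)
  rw [← ENNReal.ofReal_rpow_of_nonneg (by positivity) (by positivity),
    ENNReal.ofReal_sum_of_nonneg (fun _ _ => by positivity), ENNReal.ofReal_mul (by norm_num),
    ENNReal.ofReal_mul (by positivity), ENNReal.ofReal_sum_of_nonneg (fun _ _ => by positivity),
    ENNReal.ofReal_inv_of_pos (by positivity), ENNReal.ofReal_pow (by norm_num)] at h
  simpa only [ENNReal.ofReal_pow (norm_nonneg _), ofReal_norm,
    ← ENNReal.ofReal_rpow_of_nonneg (norm_nonneg _) hp0.le, ENNReal.ofReal_ofNat] using h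

/-! ### Square function estimates on the cubes. -/

section Cubes

variable {n : ℕ}

/-- The centre of the unit cube that contains `x`. -/
noncomputable def cubeIndex (x : EuclideanSpace ℝ (Fin n)) : Fin n → ℤ := fun i => ⌈x i - 1 / 2⌉

theorem measurable_cubeIndex : Measurable (cubeIndex (n := n)) :=
  measurable_pi_lambda _ fun i => Int.measurable_ceil.comp (by fun_prop)

/-- The ceiling is constant on intervals open on the left and closed on the right, like the sides of
the cubes. -/
theorem cubeIndex_preimage (a : Fin n → ℤ) : cubeIndex ⁻¹' {a} = cube a := by
  ext x
  simp only [cubeIndex, Set.mem_preimage, Set.mem_singleton_iff, cube, Set.mem_ofPred_eq,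
    Set.mem_Ioc, funext_iff, Int.ceil_eq_iff]
  refine forall_congr' fun i => ⟨fun h => ⟨?_, ?_⟩, fun h => ⟨?_, ?_⟩⟩ <;> linarith [h.1, h.2]

variable (lam : (Fin n → ℤ) → Set.Ioi (0 : ℝ)) {p : ℝ≥0∞}

theorem localNorm_eq (hp0 : p ≠ 0) (hpt : p ≠ ∞) (f : LZero n) (a : Fin n → ℤ) :
    localNorm lam p f a = ENNReal.ofReal (lam a) *
      (∫⁻ x in cubeIndex ⁻¹' {a}, ‖f x‖ₑ ^ p.toReal) ^ (1 / p.toReal) := by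
  have h := eLpNorm_const_smul ((lam a : ℝ) : ℂ) ((cube a).indicator (f : _ → ℂ)) p volume
  rw [eLpNorm_indicator_eq_eLpNorm_restrict (measurableSet_cube a),
    eLpNorm_eq_lintegral_rpow_enorm_toReal (f := (f : _ → ℂ)) hp0 hpt] at h
  rw [cubeIndex_preimage]
  refine h.trans ?_
  congr 1
  rw [← ofReal_norm, Complex.norm_real, Real.norm_of_nonneg (le_of_lt (lam a).2)]

theorem ellTwoNorm_sq (hp0 : p ≠ 0) (hpt : p ≠ ∞) (f : LZero n) :
    ellTwoNorm lam p f ^ 2 = ∑' a, ENNReal.ofReal (lam a) ^ 2 *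
      (∫⁻ x in cubeIndex ⁻¹' {a}, ‖f x‖ₑ ^ p.toReal) ^ (2 / p.toReal) := by
  rw [ellTwoNorm, ← ENNReal.rpow_two, ← ENNReal.rpow_mul]
  norm_num
  refine tsum_congr fun a => ?_
  rw [localNorm_eq lam hp0 hpt, mul_pow, ← ENNReal.rpow_two (_ ^ _), ← ENNReal.rpow_mul]
  congr 2
  ring

variable [Fact (1 ≤ p)] {H : Type*} [NormedAddCommGroup H] [InnerProductSpace ℂ H]

theorem coe_map_signSum_ae (T : H →L[ℂ] ellTwo lam p) {m : ℕ} (v : Fin m → H)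
    (ε : Fin m → Bool) :
    ∀ᵐ x, (T (signSum v ε) : LZero n) x = signSum (fun j => (T (v j) : LZero n) x) ε := by
  have h : (T (signSum v ε) : LZero n) = signSum (fun j => (T (v j) : LZero n)) ε := by
    simp only [signSum, map_sum, AddSubmonoidClass.coe_finsetSum]
    refine Finset.sum_congr rfl fun j _ => ?_
    split_ifs <;> simp
  rw [h]
  have hsum : ∀ s : Finset (Fin m), ∀ᵐ x,
      (∑ j ∈ s, if ε j then (T (v j) : LZero n) else -(T (v j) : LZero n) : LZero n) x =
        ∑ j ∈ s, if ε j then (T (v j) : LZero n) x else -(T (v j) : LZero n) x := by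
    intro s
    classical
    induction s using Finset.induction_on with
    | empty =>
      simp only [Finset.sum_empty]
      exact AEEqFun.coeFn_zero
    | insert j s hj ih =>
      simp only [Finset.sum_insert hj]
      filter_upwards [ih, AEEqFun.coeFn_add (if ε j then (T (v j) : LZero n) else
        -(T (v j) : LZero n)) (∑ j ∈ s, if ε j then (T (v j) : LZero n) else
        -(T (v j) : LZero n)), AEEqFun.coeFn_neg (T (v j) : LZero n)] with x h1 h2 h3
      rw [h2, Pi.add_apply, h1]
      split_ifs
      · rfl
      · rw [h3, Pi.neg_apply]
  exact hsum Finset.univ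

theorem ellTwoNorm_map_le (T : H →L[ℂ] ellTwo lam p) (u : H) :
    ellTwoNorm lam p (T u : LZero n) ≤ ENNReal.ofReal (‖T‖ * ‖u‖) := by
  rw [← ENNReal.ofReal_toReal (T u).2.ne]
  exact ENNReal.ofReal_le_ofReal (T.le_opNorm u)

/-- Square functions of operators from a Hilbert space into `ℓ²_λ(L^p)` are bounded. -/
theorem squareFunction_le (hp2 : p < 2) (T : H →L[ℂ] ellTwo lam p) {m : ℕ} (v : Fin m → H) :
    ∑' a, ENNReal.ofReal (lam a) ^ 2 * (∫⁻ x in cubeIndex ⁻¹' {a},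
      (∑ j, ‖(T (v j) : LZero n) x‖ₑ ^ 2) ^ (p.toReal / 2)) ^ (2 / p.toReal) ≤
      ENNReal.ofReal (144 * ‖T‖ ^ 2 * ∑ j, ‖v j‖ ^ 2) := by
  have hp0 : p ≠ 0 := (zero_lt_one.trans_le (Fact.out : 1 ≤ p)).ne'
  have hpt : p ≠ ∞ := (hp2.trans ENNReal.ofNat_lt_top).ne
  have hP1 : 1 ≤ p.toReal := by
    simpa using ENNReal.toReal_mono hpt (Fact.out : 1 ≤ p)
  have hP2 : p.toReal ≤ 2 := by
    simpa using ENNReal.toReal_mono ENNReal.ofNat_ne_top hp2.le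
  set P := p.toReal
  have hP0 : 0 < P := by linarith
  -- The lower bound gives Jensen's inequality for the average over signs; the upper one below turns
  -- `12 ^ (2 / P)` into at most `144`.
  have hs1 : 1 ≤ 2 / P := by rw [le_div_iff₀ hP0]; linarith
  have hs2 : 2 / P ≤ 2 := by rw [div_le_iff₀ hP0]; linarith
  set J : (Fin m → Bool) → (Fin n → ℤ) → ℝ≥0∞ := fun ε a =>
    ∫⁻ x in cubeIndex ⁻¹' {a}, ‖(T (signSum v ε) : LZero n) x‖ₑ ^ P with hJ
  have h2m : ((2 : ℝ≥0∞) ^ m) ≠ 0 := by positivity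
  have h2m' : ((2 : ℝ≥0∞) ^ m) ≠ ∞ := ENNReal.pow_ne_top ENNReal.ofNat_ne_top
  have hloc : ∀ a, (∫⁻ x in cubeIndex ⁻¹' {a},
      (∑ j, ‖(T (v j) : LZero n) x‖ₑ ^ 2) ^ (P / 2)) ^ (2 / P) ≤
      144 * ((2 ^ m)⁻¹ * ∑ ε, J ε a ^ (2 / P)) := by
    intro a
    have h1 : ∫⁻ x in cubeIndex ⁻¹' {a}, (∑ j, ‖(T (v j) : LZero n) x‖ₑ ^ 2) ^ (P / 2) ≤
        12 * ∑ ε, (2 ^ m)⁻¹ * J ε a := by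
      have hm : ∀ ε, Measurable fun x => ‖(T (signSum v ε) : LZero n) x‖ₑ ^ P := fun ε =>
        (AEEqFun.stronglyMeasurable _).measurable.enorm.pow_const _
      rw [← Finset.mul_sum, ← lintegral_finsetSum _ fun ε _ => hm ε,
        ← lintegral_const_mul _ (Finset.measurable_fun_sum _ fun ε _ => hm ε),
        ← lintegral_const_mul _ ((Finset.measurable_fun_sum _ fun ε _ => hm ε).const_mul _)]
      refine lintegral_mono_ae ?_
      filter_upwards [ae_restrict_of_ae (ae_all_iff.2 (coe_map_signSum_ae lam T v))] with x hx
      simp only [hx]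
      exact khinchine_enorm _ hP0 hP2
    calc _ ≤ (12 * ∑ ε, (2 ^ m)⁻¹ * J ε a) ^ (2 / P) := by gcongr
      _ = 12 ^ (2 / P) * (∑ ε, (2 ^ m)⁻¹ * J ε a) ^ (2 / P) :=
          ENNReal.mul_rpow_of_nonneg _ _ (by positivity)
      _ ≤ 12 ^ (2 : ℝ) * ∑ ε, (2 ^ m)⁻¹ * J ε a ^ (2 / P) := by
          gcongr
          · norm_num
          · refine ENNReal.rpow_arith_mean_le_arith_mean_rpow _ _ _ ?_ hs1
            simp [ENNReal.mul_inv_cancel h2m h2m']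
      _ = _ := by
          rw [← Finset.mul_sum]
          norm_num
  -- The signs are real, so the second moment identity is used over `ℝ`.
  let _ : InnerProductSpace ℝ H := InnerProductSpace.rclikeToReal ℂ H
  calc _ ≤ ∑' a, ENNReal.ofReal (lam a) ^ 2 *
        (144 * ((2 ^ m)⁻¹ * ∑ ε, J ε a ^ (2 / P))) := by
        gcongr with a
        exact hloc a
    _ = 144 * ((2 ^ m)⁻¹ * ∑ ε, ∑' a, ENNReal.ofReal (lam a) ^ 2 * J ε a ^ (2 / P)) := by
        rw [← Summable.tsum_finsetSum fun _ _ => ENNReal.summable, ← ENNReal.tsum_mul_left,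
          ← ENNReal.tsum_mul_left]
        refine tsum_congr fun a => ?_
        rw [← Finset.mul_sum]
        ring
    _ ≤ 144 * ((2 ^ m)⁻¹ * ∑ ε, ENNReal.ofReal (‖T‖ * ‖signSum v ε‖) ^ 2) := by
        gcongr with ε
        rw [← ellTwoNorm_sq lam hp0 hpt]
        gcongr
        exact ellTwoNorm_map_le lam T _
    _ = _ := by
        simp only [← ENNReal.ofReal_pow (mul_nonneg (norm_nonneg T) (norm_nonneg _)), mul_pow]
        rw [← ENNReal.ofReal_sum_of_nonneg fun _ _ => by positivity, ← Finset.mul_sum,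
          sum_norm_sq_signSum]
        have e : ((2 : ℝ≥0∞) ^ m)⁻¹ = ENNReal.ofReal ((2 ^ m)⁻¹) := by
          rw [ENNReal.ofReal_inv_of_pos (by positivity), ENNReal.ofReal_pow (by norm_num)]
          simp
        rw [e, ← ENNReal.ofReal_mul (by positivity),
          show (144 : ℝ≥0∞) = ENNReal.ofReal 144 by simp, ← ENNReal.ofReal_mul (by positivity)]
        congr 1
        field_simp

/-- The weights are absorbed by replacing `u` with `√(t u) • u`. This is the form in which minimax
tests finite combinations. -/
theorem weightedSquareFunction_le (hp2 : p < 2) (T : H →L[ℂ] ellTwo lam p) (s : Finset H)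
    (t : H → ℝ) (ht : ∀ u, 0 ≤ t u) :
    ∑' a, ENNReal.ofReal (lam a) ^ 2 * (∫⁻ x in cubeIndex ⁻¹' {a},
      (∑ u ∈ s, ENNReal.ofReal (t u) * ‖(T u : LZero n) x‖ₑ ^ 2) ^ (p.toReal / 2)) ^
        (2 / p.toReal) ≤ ENNReal.ofReal (∑ u ∈ s, t u * (144 * ‖T‖ ^ 2 * ‖u‖ ^ 2)) := by
  set e := s.equivFin.symm
  set v : Fin s.card → H := fun j => ((Real.sqrt (t (e j)) : ℝ) : ℂ) • (e j : H) with hv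
  have hnorm : ∀ u, ‖((Real.sqrt (t u) : ℝ) : ℂ)‖ ^ 2 = t u := fun u => by
    rw [Complex.norm_real, Real.norm_of_nonneg (Real.sqrt_nonneg _), Real.sq_sqrt (ht u)]
  have hae : ∀ᵐ x, ∑ u ∈ s, ENNReal.ofReal (t u) * ‖(T u : LZero n) x‖ₑ ^ 2 =
      ∑ j, ‖(T (v j) : LZero n) x‖ₑ ^ 2 := by
    have : ∀ᵐ x, ∀ j, (T (v j) : LZero n) x =
        ((Real.sqrt (t (e j)) : ℝ) : ℂ) * (T (e j : H) : LZero n) x := by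
      refine ae_all_iff.2 fun j => ?_
      have h : (T (v j) : LZero n) =
          ((Real.sqrt (t (e j)) : ℝ) : ℂ) • (T (e j : H) : LZero n) := by
        simp only [hv, map_smul]
        rfl
      rw [h]
      exact AEEqFun.coeFn_smul _ _
    filter_upwards [this] with x hx
    rw [← Finset.sum_coe_sort s, ← e.sum_comp]
    refine Finset.sum_congr rfl fun j _ => ?_
    rw [hx, enorm_mul, mul_pow]
    congr 1
    rw [← ofReal_norm, ← ENNReal.ofReal_pow (norm_nonneg _), hnorm]
  have hsum : ∑ u ∈ s, t u * (144 * ‖T‖ ^ 2 * ‖u‖ ^ 2) = 144 * ‖T‖ ^ 2 * ∑ j, ‖v j‖ ^ 2 := by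
    rw [← Finset.sum_coe_sort s, ← e.sum_comp, Finset.mul_sum]
    refine Finset.sum_congr rfl fun j _ => ?_
    rw [hv]
    simp only [norm_smul, mul_pow, hnorm]
    ring
  rw [hsum]
  refine le_trans (le_of_eq ?_) (squareFunction_le lam hp2 T v)
  refine tsum_congr fun a => ?_
  congr 2
  refine lintegral_congr_ae ?_
  filter_upwards [ae_restrict_of_ae hae] with x hx
  rw [hx]

end Cubes

/-! ### The common weight and division by it. -/

section Factorization

variable {n : ℕ} (lam : (Fin n → ℤ) → Set.Ioi (0 : ℝ)) {p q : ℝ≥0∞} [Fact (1 ≤ p)]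
  {H : Type*} [NormedAddCommGroup H] [InnerProductSpace ℂ H]

/-- The change of density: a single weight `w` for which all `|Tu|²` are integrable against the
corresponding power of `w`. -/
theorem exists_weight (hp2 : p < 2) {Q : ℝ} (hQ : 0 < Q) (hpQ : 1 / p.toReal = 1 / 2 + 1 / Q)
    (T : H →L[ℂ] ellTwo lam p) {c : (Fin n → ℤ) → NNReal} (hc0 : ∀ a, 0 < c a)
    (hc : ∑' a, (c a : ℝ≥0∞) ≤ 1) :
    ∃ w ∈ fiberBall (volume : Measure (EuclideanSpace ℝ (Fin n))) cubeIndex c, ∀ u : H,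
      ∫⁻ x, ‖(T u : LZero n) x‖ₑ ^ 2 * (ENNReal.ofReal (lam (cubeIndex x)) ^ 2 *
        (c (cubeIndex x) : ℝ≥0∞) ^ (2 / Q)) * ENNReal.ofReal (w x) ^ (-(4 / Q)) ≤
      ENNReal.ofReal (144 * ‖T‖ ^ 2 * ‖u‖ ^ 2 + 1) := by
  have hpt : p ≠ ∞ := (hp2.trans ENNReal.ofNat_lt_top).ne
  have hP0 : 0 < p.toReal :=
    ENNReal.toReal_pos (zero_lt_one.trans_le (Fact.out : 1 ≤ p)).ne' hpt
  set κ : EuclideanSpace ℝ (Fin n) → ℝ≥0∞ := fun x => ENNReal.ofReal (lam (cubeIndex x)) ^ 2 *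
        (c (cubeIndex x) : ℝ≥0∞) ^ (2 / Q) with hκ
  have hκm : Measurable κ := (Measurable.of_discrete (f := fun a : Fin n → ℤ =>
    ENNReal.ofReal (lam a) ^ 2 * (c a : ℝ≥0∞) ^ (2 / Q))).comp measurable_cubeIndex
  have hκt : ∀ x, κ x ≠ ∞ := fun x => ENNReal.mul_ne_top (ENNReal.pow_ne_top ENNReal.ofReal_ne_top)
    (ENNReal.rpow_ne_top_of_nonneg (by positivity) ENNReal.coe_ne_top)
  have hTm : ∀ u, Measurable fun x => ‖(T u : LZero n) x‖ₑ ^ 2 := fun u =>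
    (AEEqFun.stronglyMeasurable _).measurable.enorm.pow_const _
  have hψc : Continuous fun y : ℝ => ENNReal.ofReal y ^ (-(4 / Q)) :=
    ENNReal.continuous_rpow_const.comp ENNReal.continuous_ofReal
  -- The `+ 1` in the goal is the strict slack that minimax needs, also at `u = 0`. It is harmless,
  -- since `exists_divOp` needs only a bound on the unit ball.
  refine exists_forall_le_of_forall_finset_sum_le (convex_fiberBall measurable_cubeIndex c)
    (isClosed_fiberBall measurable_cubeIndex c) 1
    (fun w hw => norm_le_one_of_mem_fiberBall measurable_cubeIndex hc hw)
    (fun (u : H) (w : Lp ℝ 2 volume) => ∫⁻ x, ‖(T u : LZero n) x‖ₑ ^ 2 * κ x *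
      ENNReal.ofReal (w x) ^ (-(4 / Q)))
    (fun u => lintegral_mul_convex _ ((hTm u).mul hκm) _ hψc.measurable
      (ofReal_rpow_neg_convex (by positivity)))
    (fun u => isClosed_lintegral_mul_le _ ((hTm u).mul hκm)
      (fun x => ENNReal.mul_ne_top (ENNReal.pow_ne_top enorm_ne_top) (hκt x)) _ hψc)
    _ (fun u => 144 * ‖T‖ ^ 2 * ‖u‖ ^ 2) (fun u => by positivity) (fun u => by linarith) ?_
  intro s t ht
  obtain ⟨w, hw, hwle⟩ := exists_mem_fiberBall_lintegral_le
    (μ := (volume : Measure (EuclideanSpace ℝ (Fin n)))) measurable_cubeIndex hc0 hc hP0 hQ hpQ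
    (fun x => ∑ u ∈ s, ENNReal.ofReal (t u) * ‖(T u : LZero n) x‖ₑ ^ 2)
    (Finset.measurable_fun_sum _ fun u _ => (hTm u).const_mul _)
    (fun x => (ENNReal.sum_lt_top.2 fun u _ => ENNReal.mul_lt_top ENNReal.ofReal_lt_top
      (ENNReal.pow_lt_top enorm_lt_top)).ne) (fun a => ENNReal.ofReal (lam a) ^ 2)
  refine ⟨w, hw, le_trans (le_of_eq ?_)
    (hwle.trans (weightedSquareFunction_le lam hp2 T s t ht))⟩
  have hm : ∀ u, Measurable fun x => ‖(T u : LZero n) x‖ₑ ^ 2 * κ x *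
      ENNReal.ofReal (w x) ^ (-(4 / Q)) := fun u =>
    ((hTm u).mul hκm).mul (hψc.measurable.comp (Lp.stronglyMeasurable w).measurable)
  simp_rw [← lintegral_const_mul _ (hm _)]
  rw [← lintegral_finsetSum _ fun u _ => (hm u).const_mul _]
  refine lintegral_congr fun x => ?_
  rw [Finset.sum_mul, Finset.sum_mul]
  exact Finset.sum_congr rfl fun u _ => by ring

/-- A linear map from a normed space to `L²` given by dividing by a fixed function is continuous if
it is bounded on the unit ball. -/
theorem exists_divOp (T : H →L[ℂ] ellTwo lam p) (g : LZero n) (C : ℝ)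
    (hg : ∀ u : H, ∫⁻ x, ‖(T u : LZero n) x / g x‖ₑ ^ 2 ≤ ENNReal.ofReal (C * ‖u‖ ^ 2 + 1)) :
    ∃ R : H →L[ℂ] Lp ℂ 2 (volume : Measure (EuclideanSpace ℝ (Fin n))),
      ∀ u, ∀ᵐ x, R u x = (T u : LZero n) x / g x := by
  have hm : ∀ u, AEStronglyMeasurable (fun x => (T u : LZero n) x / g x) volume := fun u =>
    ((AEEqFun.stronglyMeasurable _).measurable.div
      (AEEqFun.stronglyMeasurable g).measurable).aestronglyMeasurable
  have hn : ∀ u, eLpNorm (fun x => (T u : LZero n) x / g x) 2 volume ^ 2 ≤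
      ENNReal.ofReal (C * ‖u‖ ^ 2 + 1) := fun u => by
    rw [eLpNorm_eq_lintegral_rpow_enorm_toReal two_ne_zero ENNReal.ofNat_ne_top,
      ← ENNReal.rpow_two, ← ENNReal.rpow_mul]
    simpa using hg u
  have hL : ∀ u, MemLp (fun x => (T u : LZero n) x / g x) 2 volume := fun u => by
    refine ⟨hm u, ?_⟩
    have := (hn u).trans_lt ENNReal.ofReal_lt_top
    simpa using this
  let R₀ : H →ₗ[ℂ] Lp ℂ 2 (volume : Measure (EuclideanSpace ℝ (Fin n))) :=
    { toFun := fun u => (hL u).toLp _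
      map_add' := fun u v => by
        refine Lp.ext ?_
        have h : (T (u + v) : LZero n) = (T u : LZero n) + (T v : LZero n) := by
          rw [map_add]; rfl
        filter_upwards [(hL (u + v)).coeFn_toLp, (hL u).coeFn_toLp, (hL v).coeFn_toLp,
          Lp.coeFn_add ((hL u).toLp _) ((hL v).toLp _),
          AEEqFun.coeFn_add (T u : LZero n) (T v : LZero n)] with x h1 h2 h3 h4 h5
        rw [h1, h4, Pi.add_apply, h2, h3, h, h5, Pi.add_apply, add_div]
      map_smul' := fun z u => by
        refine Lp.ext ?_
        have h : (T (z • u) : LZero n) = z • (T u : LZero n) := by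
          rw [map_smul]; rfl
        filter_upwards [(hL (z • u)).coeFn_toLp, (hL u).coeFn_toLp,
          Lp.coeFn_smul z ((hL u).toLp _), AEEqFun.coeFn_smul z (T u : LZero n)]
          with x h1 h2 h3 h4
        rw [RingHom.id_apply, h1, h3, Pi.smul_apply, h2, h, h4, Pi.smul_apply, smul_eq_mul,
          smul_eq_mul, mul_div_assoc] }
  have hR : ∀ u, ‖R₀ u‖ ^ 2 ≤ |C| * ‖u‖ ^ 2 + 1 := fun u => by
    have h1 : ‖R₀ u‖ = (eLpNorm (fun x => (T u : LZero n) x / g x) 2 volume).toReal :=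
      Lp.norm_toLp _ (hL u)
    rw [h1, ← ENNReal.toReal_pow]
    refine ENNReal.toReal_le_of_le_ofReal (by positivity) ((hn u).trans ?_)
    refine ENNReal.ofReal_le_ofReal ?_
    nlinarith [le_abs_self C, sq_nonneg ‖u‖]
  -- On the unit ball `‖R₀ u‖² ≤ |C| + 1 ≤ (|C| + 2)²`.
  obtain ⟨K, hK⟩ := LinearMap.bound_of_ball_bound (r := 1) one_pos (|C| + 2) R₀ (by
    intro u hu
    have hu' : ‖u‖ < 1 := by simpa using hu
    have h2 : ‖u‖ ^ 2 ≤ 1 := pow_le_one₀ (norm_nonneg _) hu'.le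
    refine le_of_sq_le_sq ((hR u).trans ?_) (by positivity)
    nlinarith [abs_nonneg C])
  exact ⟨R₀.mkContinuous K hK, fun u => (hL u).coeFn_toLp⟩

end Factorization

end Amalgam

/-! ### The factorization theorem. -/

open Amalgam in
theorem theorem9p7 (n : ℕ) (p q : ℝ≥0∞) [Fact (1 ≤ p)] (hp1 : 1 < p) (hp2 : p < 2)
    (hpq : 1 / p = 1 / 2 + 1 / q) (lam : (Fin n → ℤ) → Set.Ioi (0 : ℝ))
    {H : Type*} [NormedAddCommGroup H] [InnerProductSpace ℂ H] [CompleteSpace H]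
    (T : H →L[ℂ] Amalgam.ellTwo lam p) :
    ∃ (R : H →L[ℂ] Lp ℂ 2 (volume : Measure (EuclideanSpace ℝ (Fin n))))
      (g : Amalgam.LZero n),
      g ∈ Amalgam.ellInfty lam q ∧
      (∀ᵐ x : EuclideanSpace ℝ (Fin n), 0 ≤ g x) ∧
      ∀ u : H, (T u : Amalgam.LZero n) = Amalgam.mulOp g (R u : Amalgam.LZero n) := by
  have hp0 : p ≠ 0 := (zero_lt_one.trans hp1).ne'
  have hqt : q ≠ ∞ := by
    rintro rfl
    simp only [one_div, ENNReal.inv_top, add_zero, inv_inj] at hpq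
    exact hp2.ne hpq
  have hq0 : q ≠ 0 := by
    rintro rfl
    simp [hp0] at hpq
  have hQ : 0 < q.toReal := ENNReal.toReal_pos hq0 hqt
  have hpQ : 1 / p.toReal = 1 / 2 + 1 / q.toReal := by
    have := congrArg ENNReal.toReal hpq
    rw [ENNReal.toReal_add (by simp) (by simpa using hq0)] at this
    simpa using this
  set Q := q.toReal with hQdef
  obtain ⟨c, hc0, hc⟩ := ENNReal.exists_pos_sum_of_countable one_ne_zero (Fin n → ℤ)
  obtain ⟨w, hw, hwT⟩ := exists_weight lam hp2 hQ hpQ T hc0 hc.le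
  -- With this factor `λ_a ‖χ_a g‖_{L^q} ≤ 1`, and `g⁻²` is the density in `exists_weight` wherever
  -- `w > 0`.
  set σ : (Fin n → ℤ) → ℝ := fun a => ((lam a : ℝ) * (c a : ℝ) ^ (1 / Q))⁻¹ with hσ
  have hlam : ∀ a, 0 < (lam a : ℝ) := fun a => (lam a).2
  have hcR : ∀ a, 0 < (c a : ℝ) := fun a => NNReal.coe_pos.2 (hc0 a)
  have hσ0 : ∀ a, 0 < σ a := fun a =>
    inv_pos.2 (mul_pos (hlam a) (Real.rpow_pos_of_pos (hcR a) _))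
  set g₀ : EuclideanSpace ℝ (Fin n) → ℝ :=
    fun x => σ (cubeIndex x) * max (w x) 0 ^ (2 / Q) with hg₀
  have hg₀0 : ∀ x, 0 ≤ g₀ x := fun x =>
    mul_nonneg (hσ0 _).le (Real.rpow_nonneg (le_max_right _ _) _)
  have hg₀m : Measurable fun x => (g₀ x : ℂ) := by
    refine Complex.measurable_ofReal.comp (Measurable.mul ?_ ?_)
    · exact (Measurable.of_discrete (f := σ)).comp measurable_cubeIndex
    · exact ((Lp.stronglyMeasurable w).measurable.max measurable_const).pow_const _
  set g : LZero n := AEEqFun.mk _ hg₀m.aestronglyMeasurable with hg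
  have hgae : ∀ᵐ x, g x = (g₀ x : ℂ) := AEEqFun.coeFn_mk _ _
  have hpt_eq : ∀ (u : H) x, 0 < w x → g x = (g₀ x : ℂ) →
      ‖(T u : LZero n) x / g x‖ₑ ^ 2 = ‖(T u : LZero n) x‖ₑ ^ 2 *
        (ENNReal.ofReal (lam (cubeIndex x)) ^ 2 * (c (cubeIndex x) : ℝ≥0∞) ^ (2 / Q)) *
          ENNReal.ofReal (w x) ^ (-(4 / Q)) := by
    intro u x hx hgx
    rw [hgx, ENNReal.ofReal_rpow_of_pos hx, ← ENNReal.ofReal_pow (hlam _).le,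
      ← ENNReal.ofReal_coe_nnreal, ENNReal.ofReal_rpow_of_pos (hcR _), ← ofReal_norm, ← ofReal_norm,
      ← ENNReal.ofReal_pow (norm_nonneg _), ← ENNReal.ofReal_pow (norm_nonneg _),
      ← ENNReal.ofReal_mul (by positivity), ← ENNReal.ofReal_mul (by positivity),
      ← ENNReal.ofReal_mul (by positivity)]
    congr 1
    have e1 : ((c (cubeIndex x) : ℝ) ^ (1 / Q)) ^ 2 = (c (cubeIndex x) : ℝ) ^ (2 / Q) := by
      rw [← Real.rpow_natCast, ← Real.rpow_mul (hcR _).le]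
      congr 1
      push_cast
      ring
    have e2 : ((w x ^ (2 / Q)) ^ 2)⁻¹ = w x ^ (-(4 / Q)) := by
      rw [← Real.rpow_natCast, ← Real.rpow_mul hx.le, ← Real.rpow_neg hx.le]
      congr 1
      push_cast
      ring
    rw [norm_div, Complex.norm_real, Real.norm_of_nonneg (hg₀0 x), hg₀, hσ]
    simp only [max_eq_left hx.le]
    rw [div_pow, mul_pow, div_eq_mul_inv, mul_inv, e2, inv_pow, inv_inv, mul_pow, e1]
    ring
  have hg_zero : ∀ x, w x ≤ 0 → g₀ x = 0 := fun x hx => by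
    simp only [hg₀, max_eq_right hx]
    rw [Real.zero_rpow (by positivity), mul_zero]
  obtain ⟨R, hR⟩ := exists_divOp lam T g (144 * ‖T‖ ^ 2) (fun u => by
    refine le_trans (lintegral_mono_ae ?_) (hwT u)
    filter_upwards [hgae] with x hx
    -- Where `w ≤ 0`, `g` vanishes and division by zero gives `0`.
    rcases le_or_gt (w x) 0 with h | h
    · rw [hx, hg_zero x h]
      simp
    · exact (hpt_eq u x h hx).le)
  refine ⟨R, g, ?_, ?_, fun u => ?_⟩
  · refine lt_of_le_of_lt (iSup_le fun a => ?_) ENNReal.one_lt_top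
    rw [localNorm_eq lam hq0 hqt]
    have h1 : ∫⁻ x in cubeIndex ⁻¹' {a}, ‖g x‖ₑ ^ Q ≤
        ENNReal.ofReal (σ a) ^ Q * (c a : ℝ≥0∞) := by
      refine le_trans ?_ (mul_le_mul_right (hw a) _)
      rw [← lintegral_const_mul _ (by
        exact (Lp.stronglyMeasurable w).measurable.enorm.pow_const _)]
      refine lintegral_mono_ae ?_
      filter_upwards [ae_restrict_of_ae hgae,
        ae_restrict_mem (measurable_cubeIndex (measurableSet_singleton a))] with x h1 h2
      have h2' : cubeIndex x = a := h2
      rw [h1, ← ofReal_norm, Complex.norm_real, Real.norm_of_nonneg (hg₀0 x), hg₀]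
      simp only [h2']
      rw [ENNReal.ofReal_mul (hσ0 a).le, ENNReal.mul_rpow_of_nonneg _ _ hQ.le]
      gcongr
      rw [← ENNReal.ofReal_rpow_of_nonneg (le_max_right _ _) (by positivity), ← ENNReal.rpow_mul,
        div_mul_cancel₀ _ hQ.ne', ENNReal.rpow_two]
      gcongr
      rw [Real.enorm_eq_ofReal_abs]
      exact ENNReal.ofReal_le_ofReal (max_le (le_abs_self _) (abs_nonneg _))
    calc _ ≤ ENNReal.ofReal (lam a) * (ENNReal.ofReal (σ a) ^ Q * (c a : ℝ≥0∞)) ^ (1 / Q) := by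
          gcongr
      _ = 1 := by
          rw [ENNReal.mul_rpow_of_nonneg _ _ (by positivity), ← ENNReal.rpow_mul,
            mul_one_div_cancel hQ.ne', ENNReal.rpow_one, ← ENNReal.ofReal_coe_nnreal,
            ENNReal.ofReal_rpow_of_pos (hcR a), ← ENNReal.ofReal_mul (hσ0 a).le,
            ← ENNReal.ofReal_mul (hlam a).le, ← ENNReal.ofReal_one]
          congr 1
          have := hlam a
          have := Real.rpow_pos_of_pos (hcR a) (1 / Q)
          simp only [hσ]
          field_simp
  · filter_upwards [hgae] with x hx
    rw [hx]
    exact_mod_cast hg₀0 x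
  · refine AEEqFun.ext ?_
    -- Where `w ≤ 0` the negative power is `∞`, so finiteness of the integrand forces `Tu = 0`
    -- there. Hence nothing is lost on the zero set of `g`.
    have hfin := ae_lt_top' (μ := (volume : Measure (EuclideanSpace ℝ (Fin n)))) ?_
      ((hwT u).trans_lt ENNReal.ofReal_lt_top).ne
    · filter_upwards [hfin, hgae, hR u, AEEqFun.coeFn_mul g (R u : LZero n)] with x h1 h2 h3 h4
      change _ = (g * (R u : LZero n) : LZero n) x
      rw [h4, Pi.mul_apply, h3]
      rcases le_or_gt (w x) 0 with h | h
      · have hT : (T u : LZero n) x = 0 := by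
          by_contra hne
          refine h1.ne ?_
          rw [ENNReal.ofReal_of_nonpos h,
            ENNReal.zero_rpow_of_neg (neg_neg_of_pos (by positivity)), ENNReal.mul_top]
          refine mul_ne_zero (by simpa using hne) (mul_ne_zero ?_ ?_)
          · simpa using hlam (cubeIndex x)
          · exact (ENNReal.rpow_pos (by simpa using hc0 _) ENNReal.coe_ne_top).ne'
        rw [hT, zero_div, mul_zero]
      · have : g x ≠ 0 := by
          rw [h2]
          exact_mod_cast (mul_pos (hσ0 _) (Real.rpow_pos_of_pos (lt_max_of_lt_left h) _)).ne'
        rw [mul_div_cancel₀ _ this]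
    · refine (((AEEqFun.stronglyMeasurable _).measurable.enorm.pow_const _).mul ?_).mul ?_
        |>.aemeasurable
      · exact (Measurable.of_discrete (f := fun a : Fin n → ℤ =>
          ENNReal.ofReal (lam a) ^ 2 * (c a : ℝ≥0∞) ^ (2 / Q))).comp measurable_cubeIndex
      · exact (Lp.stronglyMeasurable w).measurable.ennreal_ofReal.pow_const _
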